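/- A cycle on a finite set $A$ of positive integers with $|A|=m$ is a cyclic arrangement $(a_1,a_2,\ldots,a_m)$ of the elements of $A$, each used exactly once, considered up to rotation; put $a_{m+1}=a_1$. The cycle is said to have only even-odd drops if, for all $1\le i\le m$, $a_i>a_{i+1}$ implies that $a_i$ is even and $a_{i+1}$ is odd. It is called a D-cycle if, for all $1\le i\le m$, $a_i\le a_{i+1}$ when $a_i$ is odd and $a_i\ge a_{i+1}$ when $a_i$ is even. Let $\mathcal{EC}_{n}$ be the set of cycles on $[n]=\{1,2,\ldots,n\}$ with only even-odd drops, and let $\mathcal{DC}_{n}$ be the set of D-cycles on $[n]$. Let $g_n$ ($n\ge 1$) be the Genocchi numbers, defined by $$\sum_{n\ge 1} g_n\frac{x^{2n}}{(2n)!}=x\tan\frac{x}{2}.$$ Then, for every integer $n\ge 1$, $$|\mathcal{EC}_{2n}|=|\mathcal{DC}_{2n}|=g_n.$$ -/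

import Mathlib

namespace GenocchiCycles

/-- The cycle `(a₁, …, aₘ)` has only even-odd drops: whenever `aᵢ > aᵢ₊₁` (cyclically, with
`aₘ₊₁ = a₁`), `aᵢ` is even and `aᵢ₊₁` is odd. -/
def HasOnlyEvenOddDrops (c : Cycle ℕ) : Prop :=
  c.Chain fun a b => b < a → Even a ∧ Odd b

/-- The cycle `(a₁, …, aₘ)` is a D-cycle: for all `i` (cyclically, with `aₘ₊₁ = a₁`),
`aᵢ ≤ aᵢ₊₁` if `aᵢ` is odd and `aᵢ ≥ aᵢ₊₁` if `aᵢ` is even. -/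
def IsDCycle (c : Cycle ℕ) : Prop :=
  c.Chain fun a b => (Odd a → a ≤ b) ∧ (Even a → b ≤ a)

/-- The cycles on the multiset `M` with only even-odd drops. -/
def ECOn (M : Multiset ℕ) : Set (Cycle ℕ) :=
  {c | c.toMultiset = M ∧ HasOnlyEvenOddDrops c}

/-- The D-cycles on the multiset `M`. -/
def DCOn (M : Multiset ℕ) : Set (Cycle ℕ) :=
  {c | c.toMultiset = M ∧ IsDCycle c}

/-- The cycles on `[n] = {1, …, n}` with only even-odd drops. -/
def EC (n : ℕ) : Set (Cycle ℕ) := ECOn (Finset.Icc 1 n).val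

/-- The D-cycles on `[n] = {1, …, n}`. -/
def DC (n : ℕ) : Set (Cycle ℕ) := DCOn (Finset.Icc 1 n).val

theorem finite_cycles (M : Multiset ℕ) : {c : Cycle ℕ | c.toMultiset = M}.Finite := by
  induction M using Quotient.inductionOn with
  | _ l =>
    refine (l.permutations.toFinset.finite_toSet.image (fun l' : List ℕ => (l' : Cycle ℕ))).subset ?_
    intro c hc
    induction c using Quotient.inductionOn with
    | _ l' =>
      refine ⟨l', ?_, rfl⟩
      simpa using (Multiset.coe_eq_coe.1 hc : l'.Perm l)

theorem finite_EC (n : ℕ) : (EC n).Finite := (finite_cycles _).subset fun _ h => h.1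

theorem finite_DC (n : ℕ) : (DC n).Finite := (finite_cycles _).subset fun _ h => h.1

open PowerSeries in
/-- The formal power series `x * tan (x / 2) = x * sin (x / 2) / cos (x / 2)` over `ℚ`. -/
noncomputable def xTanHalf : PowerSeries ℚ :=
  X * (rescale (1 / 2 : ℚ) (sin ℚ) * (rescale (1 / 2 : ℚ) (cos ℚ))⁻¹)

/-- The Genocchi number `g n`, for `n ≥ 1`, given by
`∑_{n ≥ 1} g n * x ^ (2 * n) / (2 * n)! = x * tan (x / 2)`. -/
noncomputable def genocchi (n : ℕ) : ℚ :=
  ((2 * n).factorial : ℚ) * PowerSeries.coeff (2 * n) xTanHalf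

open PowerSeries in
theorem constantCoeff_cos_half : constantCoeff (rescale (1 / 2 : ℚ) (cos ℚ)) ≠ 0 := by
  rw [← coeff_zero_eq_constantCoeff_apply, coeff_rescale]
  simp [cos]

open PowerSeries in
theorem xTanHalf_mul_cos :
    xTanHalf * rescale (1 / 2 : ℚ) (cos ℚ) = X * rescale (1 / 2 : ℚ) (sin ℚ) := by
  rw [xTanHalf, mul_assoc, mul_assoc, PowerSeries.inv_mul_cancel _ constantCoeff_cos_half, mul_one]

open PowerSeries in
/-- The generating function identity that defines the Genocchi numbers. -/
theorem genocchi_generatingFunction :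
    (PowerSeries.mk fun k => if Even k ∧ k ≠ 0 then genocchi (k / 2) / (k.factorial : ℚ) else 0)
      = xTanHalf := by
  have hc : rescale (-1 : ℚ) (rescale (1 / 2 : ℚ) (cos ℚ)) = rescale (1 / 2 : ℚ) (cos ℚ) := by
    ext k
    rcases Nat.even_or_odd k with h | h
    · simp [coeff_rescale, h]
    · simp [coeff_rescale, cos, Nat.not_even_iff_odd.2 h]
  have hs : rescale (-1 : ℚ) (X * rescale (1 / 2 : ℚ) (sin ℚ))
      = X * rescale (1 / 2 : ℚ) (sin ℚ) := by
    ext k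
    rcases k with _ | k
    · simp
    · rcases Nat.even_or_odd k with h | h
      · simp [coeff_rescale, coeff_succ_X_mul, sin, h]
      · simp [coeff_rescale, coeff_succ_X_mul, h.neg_one_pow]
  have hne : rescale (1 / 2 : ℚ) (cos ℚ) ≠ 0 := fun h => constantCoeff_cos_half (by rw [h]; simp)
  have hx : rescale (-1 : ℚ) xTanHalf = xTanHalf := by
    apply mul_right_cancel₀ hne
    have := congrArg (rescale (-1 : ℚ)) xTanHalf_mul_cos
    rwa [map_mul, hc, hs, ← xTanHalf_mul_cos] at this
  ext k
  rw [coeff_mk]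
  rcases Nat.even_or_odd k with h | h
  · by_cases h0 : k = 0
    · subst h0
      simp [xTanHalf]
    · have hk : (k.factorial : ℚ) ≠ 0 := by exact_mod_cast k.factorial_ne_zero
      rw [if_pos ⟨h, h0⟩, genocchi, Nat.two_mul_div_two_of_even h]
      field_simp
  · have := congrArg (coeff k) hx
    rw [coeff_rescale, h.neg_one_pow] at this
    rw [if_neg fun h' => Nat.not_even_iff_odd.2 h h'.1]
    linarith

end GenocchiCycles

/-! Both families satisfy the same recurrence. Cut a cycle on `[N]`, `N` even, at its maximum `N`:
what remains is a list that forms a chain between two copies of `N`. More generally, count families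
of such lists, indexed by `ι`, that jointly use `[m]`, and remove the maximum `m`. If `m` is odd, it
must be followed by `N`, so it ends its list, and the count is `|ι|` times the count for `[m-1]`. If
`m` is even, it behaves towards smaller elements essentially as `N` does, so its list splits into
two admissible lists, exactly one of which must be nonempty: the later one for D-cycles, the earlier
one for even-odd drops. Two such steps give the recursion of `gandhi` (`Splits.ncard_Arr`), and
cycles are the case `|ι| = 1`.

It remains to prove `gandhi_one`. With `S = 4 sin²(x/2)`, expand `x tan(x/2)` in powers of `S`
(`coeff_xTanHalf_eq`). The coefficients of `S ^ k` are normalised central factorial numbers, and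
their recurrence solves that of `gandhi` in closed form (`gandhi_eq_sum`). -/

namespace GenocchiCycles

/-! ### Genocchi numbers as values of the Gandhi recursion -/

section PowerSeriesSide

open PowerSeries

/-- The power series `sin (x / 2)`. -/
noncomputable def sinHalf : PowerSeries ℚ := rescale (1 / 2 : ℚ) (sin ℚ)

/-- The power series `cos (x / 2)`. -/
noncomputable def cosHalf : PowerSeries ℚ := rescale (1 / 2 : ℚ) (cos ℚ)

theorem two_mul_derivative_sinHalf : 2 * d⁄dX ℚ sinHalf = cosHalf := by
  ext n
  rw [two_mul, map_add, coeff_derivative, sinHalf, cosHalf, coeff_rescale, coeff_rescale]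
  rcases Nat.even_or_odd n with h | h
  · obtain ⟨m, rfl⟩ := h
    have h1 : (m + m + 1) / 2 = m := by omega
    have h2 : (m + m) / 2 = m := by omega
    simp only [sin, cos, coeff_mk, Nat.even_add_one, Even.add_self, not_true_eq_false,
      if_false, if_true, h1, h2, Nat.factorial_succ]
    simp
    have : ((m + m).factorial : ℚ) ≠ 0 := by positivity
    have : ((m : ℚ) + m + 1) ≠ 0 := by positivity
    field_simp
    ring
  · have h' : Even (n + 1) := h.add_one
    simp [sin, cos, h', Nat.not_even_iff_odd.2 h]

theorem two_mul_derivative_cosHalf : 2 * d⁄dX ℚ cosHalf = -sinHalf := by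
  ext n
  rw [two_mul, map_add, map_neg, coeff_derivative, sinHalf, cosHalf, coeff_rescale, coeff_rescale]
  rcases Nat.even_or_odd n with h | h
  · have h' : ¬ Even (n + 1) := by simpa [Nat.even_add_one] using h
    simp [sin, cos, h', h]
  · obtain ⟨m, rfl⟩ := h
    have h1 : (2 * m + 1 + 1) / 2 = m + 1 := by omega
    have h2 : (2 * m + 1) / 2 = m := by omega
    have h3 : Even (2 * m + 1 + 1) := ⟨m + 1, by ring⟩
    have h4 : ¬ Even (2 * m + 1) := by simp
    simp only [sin, cos, coeff_mk, h3, h4, if_false, if_true, h1, h2,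
      Nat.factorial_succ (2 * m + 1)]
    simp
    have : ((2 * m + 1).factorial : ℚ) ≠ 0 := by positivity
    have : (2 * (m : ℚ) + 1 + 1) ≠ 0 := by positivity
    field_simp
    ring

theorem constantCoeff_sinHalf : constantCoeff sinHalf = 0 := by
  rw [← coeff_zero_eq_constantCoeff_apply, sinHalf, coeff_rescale]
  simp [sin]

theorem constantCoeff_cosHalf : constantCoeff cosHalf = 1 := by
  rw [← coeff_zero_eq_constantCoeff_apply, cosHalf, coeff_rescale]
  simp [cos]

theorem sinHalf_sq_add_cosHalf_sq : sinHalf ^ 2 + cosHalf ^ 2 = 1 := by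
  apply derivative.ext (R := ℚ)
  · rw [map_add, derivative_pow, derivative_pow, derivative_one]
    push_cast
    linear_combination sinHalf * two_mul_derivative_sinHalf
      + cosHalf * two_mul_derivative_cosHalf
  · simp [constantCoeff_sinHalf, constantCoeff_cosHalf]

/-- The power series `4 * sin (x / 2) ^ 2 = 2 - 2 * cos x`. -/
noncomputable def chordSq : PowerSeries ℚ := 4 * sinHalf ^ 2

theorem derivative_chordSq : d⁄dX ℚ chordSq = 4 * sinHalf * cosHalf := by
  have h4 : d⁄dX ℚ (4 : PowerSeries ℚ) = 0 := by
    rw [← map_ofNat (C (R := ℚ)) 4, derivative_C]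
  rw [chordSq, Derivation.leibniz, derivative_pow, h4]
  simp only [smul_eq_mul]
  push_cast
  linear_combination 4 * sinHalf * two_mul_derivative_sinHalf

theorem derivative_derivative_chordSq : d⁄dX ℚ (d⁄dX ℚ chordSq) = 2 - chordSq := by
  have h4 : d⁄dX ℚ (4 : PowerSeries ℚ) = 0 := by
    rw [← map_ofNat (C (R := ℚ)) 4, derivative_C]
  rw [derivative_chordSq, chordSq, Derivation.leibniz, Derivation.leibniz, h4]
  simp only [smul_eq_mul]
  linear_combination 2 * cosHalf * two_mul_derivative_sinHalf
    + 2 * sinHalf * two_mul_derivative_cosHalf + 2 * sinHalf_sq_add_cosHalf_sq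

theorem derivative_chordSq_sq : (d⁄dX ℚ chordSq) ^ 2 = 4 * chordSq - chordSq ^ 2 := by
  rw [derivative_chordSq, chordSq]
  linear_combination 16 * sinHalf ^ 2 * sinHalf_sq_add_cosHalf_sq

theorem derivative_chordSq_pow_mul (k : ℕ) :
    d⁄dX ℚ (chordSq ^ (k + 1)) * d⁄dX ℚ chordSq
      = (k + 1) * (4 * chordSq ^ (k + 1) - chordSq ^ (k + 2)) := by
  rw [derivative_pow]
  push_cast
  linear_combination (k + 1) * chordSq ^ k * derivative_chordSq_sq

theorem derivative_derivative_chordSq_pow (k : ℕ) :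
    d⁄dX ℚ (d⁄dX ℚ (chordSq ^ (k + 1)))
      = (k + 1) * ((4 * k + 2) * chordSq ^ k - (k + 1) * chordSq ^ (k + 1)) := by
  have hk : d⁄dX ℚ ((k + 1 : ℕ) : PowerSeries ℚ) = 0 := by
    simp
  rw [derivative_pow, Derivation.leibniz, Derivation.leibniz, hk,
    derivative_derivative_chordSq, Nat.add_sub_cancel]
  simp only [smul_eq_mul]
  rcases k with _ | k
  · simp
  · have := derivative_chordSq_pow_mul k
    push_cast at this ⊢
    linear_combination (k + 2 : PowerSeries ℚ) * this

theorem X_sq_dvd_chordSq : (X : PowerSeries ℚ) ^ 2 ∣ chordSq :=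
  (pow_dvd_pow_of_dvd (X_dvd_iff.2 constantCoeff_sinHalf) 2).mul_left 4

/-- The first-order linear equation that determines the expansion in powers of `chordSq`. The
homogeneous equation is solved by multiples of `tan (x / 2)`, which has order 1, so a solution
divisible by `X ^ 2` is unique. -/
theorem derivative_xTanHalf_mul :
    d⁄dX ℚ xTanHalf * d⁄dX ℚ chordSq = 2 * xTanHalf + chordSq := by
  have h : xTanHalf * cosHalf = X * sinHalf := xTanHalf_mul_cos
  have h' := congrArg (d⁄dX ℚ) h
  rw [Derivation.leibniz, Derivation.leibniz, derivative_X] at h'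
  simp only [smul_eq_mul] at h'
  rw [derivative_chordSq, chordSq]
  linear_combination 4 * sinHalf * h' + 2 * X * sinHalf * two_mul_derivative_sinHalf
    - 2 * xTanHalf * sinHalf * two_mul_derivative_cosHalf - 2 * cosHalf * h
    + 2 * xTanHalf * sinHalf_sq_add_cosHalf_sq

theorem X_sq_dvd_xTanHalf : (X : PowerSeries ℚ) ^ 2 ∣ xTanHalf := by
  rw [xTanHalf, sq]
  exact mul_dvd_mul_left _ ((X_dvd_iff.2 constantCoeff_sinHalf).mul_right _)

/-- The coefficient of `chordSq ^ (k + 1)` in the expansion of `x * tan (x / 2)`. -/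
def tanCoeff (k : ℕ) : ℚ := (k + 1).factorial * k.factorial / (2 * (k + 1)).factorial

/-- This ratio is what makes the powers of `chordSq` telescope in the differential equation. -/
theorem tanCoeff_succ (k : ℕ) :
    (4 * (k + 1) + 2) * tanCoeff (k + 1) = (k + 1) * tanCoeff k := by
  have h : (2 * (k + 1 + 1)).factorial = (2 * k + 4) * ((2 * k + 3) * (2 * (k + 1)).factorial) := by
    rw [show 2 * (k + 1 + 1) = 2 * (k + 1) + 1 + 1 by ring, Nat.factorial_succ, Nat.factorial_succ]
    ring
  rw [tanCoeff, tanCoeff, h, Nat.factorial_succ (k + 1), Nat.factorial_succ k]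
  push_cast
  have : ((2 * (k + 1)).factorial : ℚ) ≠ 0 := by positivity
  have : (2 * (k : ℚ) + 4) ≠ 0 := by positivity
  have : (2 * (k : ℚ) + 3) ≠ 0 := by positivity
  field_simp
  ring

/-- The partial sums of the expansion of `x * tan (x / 2)` in powers of `chordSq`. -/
noncomputable def tanPartial (K : ℕ) : PowerSeries ℚ :=
  ∑ k ∈ Finset.range K, C (tanCoeff k) * chordSq ^ (k + 1)

theorem derivative_C_mul (a : ℚ) (f : PowerSeries ℚ) :
    d⁄dX ℚ (C a * f) = C a * d⁄dX ℚ f := by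
  rw [Derivation.leibniz, derivative_C]
  simp

theorem derivative_tanPartial_mul (K : ℕ) :
    d⁄dX ℚ (tanPartial K) * d⁄dX ℚ chordSq
      = 2 * tanPartial K + chordSq - C ((4 * K + 2) * tanCoeff K) * chordSq ^ (K + 1) := by
  induction K with
  | zero => simp [tanPartial, tanCoeff]
  | succ K ih =>
    have h : tanPartial (K + 1) = tanPartial K + C (tanCoeff K) * chordSq ^ (K + 1) :=
      Finset.sum_range_succ _ _
    have h2 := derivative_chordSq_pow_mul K
    rw [h, map_add, derivative_C_mul]
    push_cast
    rw [tanCoeff_succ]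
    simp only [map_mul, map_add, map_one, map_natCast, map_ofNat] at ih ⊢
    linear_combination ih + C (tanCoeff K) * h2

/-- Quantitative uniqueness: the derivative of `chordSq` starts with `2 * X`, so a leading term of
degree `d ≥ 2` below `M` would need `2 * d = 2`. -/
theorem X_pow_dvd_of_derivative_mul {E W : PowerSeries ℚ} {M : ℕ} (h2 : X ^ 2 ∣ E)
    (hE : d⁄dX ℚ E * d⁄dX ℚ chordSq = 2 * E + X ^ M * W) (m : ℕ) (hm : m + 2 ≤ M) :
    X ^ (m + 2) ∣ E := by
  induction m with
  | zero => exact h2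
  | succ m ih =>
    obtain ⟨F, hF⟩ := ih (by omega)
    obtain ⟨M, rfl⟩ : ∃ r, M = m + 2 + 1 + r := ⟨M - (m + 2 + 1), by omega⟩
    obtain ⟨V, hV⟩ := X_dvd_iff.2 (show constantCoeff (d⁄dX ℚ chordSq) = 0 by
      rw [derivative_chordSq]; simp [constantCoeff_sinHalf])
    have hV0 : constantCoeff V = 2 := by
      have := congrArg (fun f => constantCoeff (d⁄dX ℚ f)) hV
      simp only [derivative_derivative_chordSq, Derivation.leibniz, derivative_X] at this
      simpa [chordSq, constantCoeff_sinHalf, map_ofNat] using this.symm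
    have key : ((m + 2 : ℕ) : PowerSeries ℚ) * F * V + X * d⁄dX ℚ F * V
        = 2 * F + X * (X ^ M * W) := by
      apply mul_left_cancel₀ (pow_ne_zero (m + 2) (X_ne_zero (R := ℚ)))
      rw [hV, hF, Derivation.leibniz, derivative_pow, derivative_X] at hE
      simp only [smul_eq_mul, show m + 2 - 1 = m + 1 by omega] at hE
      linear_combination hE
    have hF0 : constantCoeff F = 0 := by
      have := congrArg constantCoeff key
      simp only [map_add, map_mul, map_natCast, map_ofNat, hV0, constantCoeff_X, zero_mul,
        add_zero] at this
      push_cast at this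
      have h0 : (2 * (m : ℚ) + 2) * constantCoeff F = 0 := by linarith
      exact (mul_eq_zero.1 h0).resolve_left (by positivity)
    rw [hF, show m + 1 + 2 = m + 2 + 1 by ring, pow_succ X (m + 2)]
    exact mul_dvd_mul_left _ (X_dvd_iff.2 hF0)

theorem coeff_xTanHalf_eq (K : ℕ) :
    coeff (2 * K) xTanHalf = coeff (2 * K) (tanPartial K) := by
  have h2 : (X : PowerSeries ℚ) ^ 2 ∣ tanPartial K :=
    Finset.dvd_sum fun k _ =>
      ((X_sq_dvd_chordSq.trans (dvd_pow_self _ k.succ_ne_zero)).mul_left _)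
  obtain ⟨U, hU⟩ := X_sq_dvd_chordSq
  have hE : d⁄dX ℚ (xTanHalf - tanPartial K) * d⁄dX ℚ chordSq
      = 2 * (xTanHalf - tanPartial K)
        + X ^ (2 * K + 2) * (C ((4 * K + 2) * tanCoeff K) * U ^ (K + 1)) := by
    have hS : chordSq ^ (K + 1) = X ^ (2 * K + 2) * U ^ (K + 1) := by
      rw [hU, mul_pow, ← pow_mul]; ring_nf
    rw [map_sub]
    linear_combination derivative_xTanHalf_mul - derivative_tanPartial_mul K
      + C ((4 * K + 2) * tanCoeff K) * hS
  have := X_pow_dvd_of_derivative_mul (dvd_sub X_sq_dvd_xTanHalf h2) hE (2 * K) le_rfl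
  have h0 := X_pow_dvd_iff.1 this (2 * K) (by omega)
  rw [map_sub] at h0
  linarith

/-- The signed central factorial numbers, as normalised coefficients of the powers of
`4 * sin (x / 2) ^ 2`. -/
noncomputable def centralFactorial (n k : ℕ) : ℚ :=
  (2 * n).factorial / (2 * k).factorial * coeff (2 * n) (chordSq ^ k)

/-- Compare coefficients in the formula for the second derivative of `chordSq ^ (k + 1)`; the
factorials absorb the remaining factors. -/
theorem centralFactorial_succ_succ (n k : ℕ) :
    centralFactorial (n + 1) (k + 1)
      = centralFactorial n k - (k + 1) ^ 2 * centralFactorial n (k + 1) := by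
  have h := congrArg (coeff (2 * n)) (derivative_derivative_chordSq_pow k)
  have hr : ((k + 1) * ((4 * k + 2) * chordSq ^ k - (k + 1) * chordSq ^ (k + 1)) : PowerSeries ℚ)
      = C ((k + 1) * (4 * k + 2) : ℚ) * chordSq ^ k - C ((k + 1) ^ 2 : ℚ) * chordSq ^ (k + 1) := by
    simp only [map_mul, map_add, map_one, map_natCast, map_ofNat, map_pow]
    ring
  rw [hr, map_sub, coeff_C_mul, coeff_C_mul, coeff_derivative, coeff_derivative] at h
  have hn : (2 * (n + 1)).factorial = (2 * n + 2) * ((2 * n + 1) * (2 * n).factorial) := by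
    rw [show 2 * (n + 1) = 2 * n + 1 + 1 by ring, Nat.factorial_succ, Nat.factorial_succ]
  have hk : (2 * (k + 1)).factorial = (2 * k + 2) * ((2 * k + 1) * (2 * k).factorial) := by
    rw [show 2 * (k + 1) = 2 * k + 1 + 1 by ring, Nat.factorial_succ, Nat.factorial_succ]
  simp only [centralFactorial, hn, hk]
  rw [show 2 * (n + 1) = 2 * n + 1 + 1 by ring]
  push_cast at h ⊢
  have : ((2 * k).factorial : ℚ) ≠ 0 := by positivity
  have : (2 * (k : ℚ) + 2) ≠ 0 := by positivity
  have : (2 * (k : ℚ) + 1) ≠ 0 := by positivity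
  field_simp
  linear_combination h

theorem centralFactorial_zero_succ (k : ℕ) : centralFactorial 0 (k + 1) = 0 := by
  simp [centralFactorial, chordSq, constantCoeff_sinHalf]

theorem centralFactorial_zero_zero : centralFactorial 0 0 = 1 := by
  simp [centralFactorial]

theorem centralFactorial_succ_zero (n : ℕ) : centralFactorial (n + 1) 0 = 0 := by
  simp [centralFactorial, coeff_one]

theorem centralFactorial_eq_zero_of_lt {n k : ℕ} (h : n < k) : centralFactorial n k = 0 := by
  induction n generalizing k with
  | zero =>
    obtain ⟨k, rfl⟩ := Nat.exists_eq_succ_of_ne_zero h.ne'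
    exact centralFactorial_zero_succ k
  | succ n ih =>
    obtain ⟨k, rfl⟩ := Nat.exists_eq_succ_of_ne_zero (by omega : k ≠ 0)
    rw [centralFactorial_succ_succ, ih (by omega), ih (by omega)]
    ring

theorem genocchi_eq_sum (n : ℕ) :
    genocchi n = ∑ k ∈ Finset.range n,
      ((k + 1).factorial * k.factorial : ℚ) * centralFactorial n (k + 1) := by
  rw [genocchi, coeff_xTanHalf_eq, tanPartial, map_sum, Finset.mul_sum]
  refine Finset.sum_congr rfl fun k _ => ?_
  rw [coeff_C_mul, tanCoeff, centralFactorial]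
  ring

/-- The values at natural numbers of `x` times the Gandhi polynomials. -/
def gandhi : ℕ → ℕ → ℚ
  | 0, x => x
  | j + 1, x => x ^ 2 * (gandhi j (x + 1) - gandhi j x)

theorem gandhi_eq_sum (j a : ℕ) :
    gandhi j (a + 1) = ∑ k ∈ Finset.range (j + 1),
      ((k + a + 1).factorial * k.factorial / a.factorial : ℚ)
        * centralFactorial (j + 1) (k + 1) := by
  induction j generalizing a with
  | zero =>
    have : (a.factorial : ℚ) ≠ 0 := by positivity
    simp [gandhi, centralFactorial_succ_succ, centralFactorial_zero_succ,
      centralFactorial_zero_zero, Nat.factorial_succ]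
    field_simp
  | succ j ih =>
    rw [gandhi, ih, ih]
    have hsplit : ∀ k, centralFactorial (j + 1 + 1) (k + 1) = _ :=
      fun k => centralFactorial_succ_succ (j + 1) k
    simp only [hsplit, mul_sub, Finset.sum_sub_distrib]
    -- The boundary terms `centralFactorial (j + 1) 0` and `centralFactorial (j + 1) (j + 2)`
    -- vanish, which aligns the two ranges.
    rw [Finset.sum_range_succ' (fun k => _ * centralFactorial (j + 1) k),
      Finset.sum_range_succ (fun k => _ * (_ * centralFactorial (j + 1) (k + 1))) (j + 1),
      centralFactorial_succ_zero, centralFactorial_eq_zero_of_lt (show j + 1 < j + 1 + 1 by omega)]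
    simp only [mul_zero, add_zero]
    rw [← Finset.sum_sub_distrib, Finset.mul_sum, Finset.mul_sum, ← Finset.sum_sub_distrib]
    -- Termwise this is `(a+1)(k+a+2) - (a+1)² = (k+1)(k+a+2) - (k+1)²`, both sides being
    -- `(a+1)(k+1)`.
    refine Finset.sum_congr rfl fun k _ => ?_
    have h1 : k + (a + 1) + 1 = k + a + 1 + 1 := by ring
    have h2 : k + 1 + a + 1 = k + a + 1 + 1 := by ring
    have : (a.factorial : ℚ) ≠ 0 := by positivity
    rw [h1, h2, Nat.factorial_succ (k + a + 1), Nat.factorial_succ a, Nat.factorial_succ k]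
    push_cast
    field_simp
    ring

theorem gandhi_one (j : ℕ) : gandhi j 1 = genocchi (j + 1) := by
  rw [genocchi_eq_sum, gandhi_eq_sum j 0]
  simp

end PowerSeriesSide

end GenocchiCycles

namespace GenocchiCycles

/-! ### Families of lists and removal of one element -/

section Arrangements

open Function

/-- The families of lists, indexed by `ι`, that jointly use each element of the multiset `M`
once and all of whose members satisfy `P`. -/
def Arr (P : List ℕ → Prop) (M : Multiset ℕ) (ι : Type) [Fintype ι] : Set (ι → List ℕ) :=
  {s | ∑ i, (s i : Multiset ℕ) = M ∧ ∀ i, P (s i)}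

/-- A way to join two lists through a new element `m`. -/
structure IsJoin (m : ℕ) (c : List ℕ → List ℕ → List ℕ) : Prop where
  coe : ∀ u v, (c u v : Multiset ℕ) = m ::ₘ (u + v)
  inj : ∀ u v u' v', m ∉ u → m ∉ v → m ∉ u' → m ∉ v' → c u v = c u' v' → u = u' ∧ v = v'
  surj : ∀ l, m ∈ l → ∃ u v, l = c u v

theorem isJoin_append (m : ℕ) : IsJoin m fun u v => u ++ m :: v where
  coe u v := by
    rw [Multiset.coe_add, Multiset.cons_coe, Multiset.coe_eq_coe]
    exact List.perm_middle
  inj u v u' v' hu hv hu' hv' h := by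
    have := (List.append_cons_inj_of_notMem hu hv).1 h
    exact ⟨this.1, this.2.2⟩
  surj l hl := List.append_of_mem hl

theorem isJoin_append_swap (m : ℕ) : IsJoin m fun u v => v ++ m :: u where
  coe u v := by rw [(isJoin_append m).coe v u, add_comm]
  inj u v u' v' hu hv hu' hv' h := ((isJoin_append m).inj v u v' u' hv hu hv' hu' h).symm
  surj l hl := by
    obtain ⟨u, v, h⟩ := List.append_of_mem hl
    exact ⟨v, u, h⟩

variable {ι : Type} [DecidableEq ι]

/-- Join the list at `none` to the list at `i`. -/
def joinAt (c : List ℕ → List ℕ → List ℕ) (p : ι × (Option ι → List ℕ)) : ι → List ℕ :=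
  update (fun j => p.2 (some j)) p.1 (c (p.2 (some p.1)) (p.2 none))

/-- The index is recovered as that of the only list containing `m`, and the two pieces by splitting
that list at `m`. -/
theorem joinAt_injOn {m : ℕ} {c : List ℕ → List ℕ → List ℕ} (hc : IsJoin m c) :
    Set.InjOn (joinAt (ι := ι) c) {p | ∀ j, m ∉ p.2 j} := by
  have hm : ∀ u v, m ∈ c u v := fun u v => by
    rw [← Multiset.mem_coe, hc.coe]
    exact Multiset.mem_cons_self _ _
  rintro ⟨i, t⟩ ht ⟨i', t'⟩ ht' h
  have hi : i = i' := by
    by_contra hne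
    have h1 := congrFun h i
    simp only [joinAt, update_self, update_of_ne hne] at h1
    exact ht' (some i) (show m ∈ t' (some i) by rw [← h1]; exact hm _ _)
  subst hi
  have h1 := congrFun h i
  simp only [joinAt, update_self] at h1
  obtain ⟨h2, h3⟩ := hc.inj _ _ _ _ (ht _) (ht _) (ht' _) (ht' _) h1
  refine Prod.ext rfl (funext fun j => ?_)
  rcases j with _ | j
  · exact h3
  · by_cases hj : j = i
    · rw [hj]; exact h2
    · have h4 := congrFun h j
      simpa only [joinAt, update_of_ne hj] using h4

variable [Fintype ι]

theorem sum_coe_update (s : ι → List ℕ) (i : ι) (l : List ℕ) :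
    ∑ j, ((update s i l j : List ℕ) : Multiset ℕ) + s i = ∑ j, (s j : Multiset ℕ) + l := by
  rw [← Finset.add_sum_erase _ _ (Finset.mem_univ i),
    ← Finset.add_sum_erase (f := fun j => (s j : Multiset ℕ)) _ (Finset.mem_univ i)]
  have : ∑ j ∈ Finset.univ.erase i, ((update s i l j : List ℕ) : Multiset ℕ)
      = ∑ j ∈ Finset.univ.erase i, (s j : Multiset ℕ) :=
    Finset.sum_congr rfl fun j hj => by rw [update_of_ne (Finset.ne_of_mem_erase hj)]
  rw [this, update_self]
  abel

theorem sum_joinAt {m : ℕ} {c : List ℕ → List ℕ → List ℕ} (hc : IsJoin m c) (i : ι)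
    (t : Option ι → List ℕ) :
    ∑ j, (joinAt c (i, t) j : Multiset ℕ) = m ::ₘ ∑ j, (t j : Multiset ℕ) := by
  have h := sum_coe_update (fun j => t (some j)) i (c (t (some i)) (t none))
  rw [hc.coe] at h
  apply add_right_cancel (b := (t (some i) : Multiset ℕ))
  rw [Fintype.sum_option]
  refine h.trans ?_
  simp only [Multiset.add_cons, Multiset.cons_add]
  congr 1
  abel

theorem mem_sum_coe {κ : Type} [Fintype κ] {t : κ → List ℕ} {x : ℕ} :
    x ∈ ∑ j, (t j : Multiset ℕ) ↔ ∃ j, x ∈ t j := by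
  simp [Multiset.mem_sum]

theorem exists_joinAt {m : ℕ} {M : Multiset ℕ} {c : List ℕ → List ℕ → List ℕ} (hc : IsJoin m c)
    {s : ι → List ℕ} (hs : ∑ j, (s j : Multiset ℕ) = m ::ₘ M) :
    ∃ p : ι × (Option ι → List ℕ), joinAt c p = s := by
  obtain ⟨i, hi⟩ := mem_sum_coe.1 (hs ▸ Multiset.mem_cons_self m M)
  obtain ⟨u, v, huv⟩ := hc.surj _ hi
  refine ⟨(i, fun j => j.elim v (update s i u)), ?_⟩
  simp [joinAt, ← huv]

/-- Inserting an element which splits a list as prescribed by `Q`. -/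
theorem Arr_cons_eq_image {m : ℕ} {M : Multiset ℕ} {c : List ℕ → List ℕ → List ℕ}
    (hc : IsJoin m c) {P : List ℕ → Prop} {Q : List ℕ → Prop}
    (hP : ∀ u v, (∀ x ∈ u, x ∈ M) → (∀ x ∈ v, x ∈ M) → (P (c u v) ↔ Q v ∧ P u ∧ P v)) :
    Arr P (m ::ₘ M) ι = joinAt c '' (Set.univ ×ˢ {t ∈ Arr P M (Option ι) | Q (t none)}) := by
  have key : ∀ i t, ∑ j, (t j : Multiset ℕ) = M →
      ((∀ j, P (joinAt c (i, t) j)) ↔ Q (t none) ∧ ∀ j : Option ι, P (t j)) := by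
    intro i t ht
    have hM : ∀ j, ∀ x ∈ t j, x ∈ M := fun j x hx => ht ▸ mem_sum_coe.2 ⟨j, hx⟩
    have h := hP _ _ (hM (some i)) (hM none)
    constructor
    · intro H
      have hi := H i
      simp only [joinAt, update_self] at hi
      obtain ⟨h1, h2, h3⟩ := h.1 hi
      refine ⟨h1, fun j => ?_⟩
      rcases j with _ | j
      · exact h3
      · by_cases hj : j = i
        · rw [hj]; exact h2
        · simpa only [joinAt, update_of_ne hj] using H j
    · rintro ⟨h1, h2⟩ j
      by_cases hj : j = i
      · subst hj
        simpa only [joinAt, update_self] using h.2 ⟨h1, h2 _, h2 _⟩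
      · simpa only [joinAt, update_of_ne hj] using h2 (some j)
  ext s
  constructor
  · rintro ⟨hs, hPs⟩
    obtain ⟨⟨i, t⟩, rfl⟩ := exists_joinAt hc hs
    rw [sum_joinAt hc, Multiset.cons_inj_right] at hs
    obtain ⟨h1, h2⟩ := (key i t hs).1 hPs
    exact ⟨(i, t), ⟨Set.mem_univ _, ⟨hs, h2⟩, h1⟩, rfl⟩
  · rintro ⟨⟨i, t⟩, ⟨-, ⟨ht, h2⟩, h1⟩, rfl⟩
    exact ⟨by rw [sum_joinAt hc, ht], (key i t ht).2 ⟨h1, h2⟩⟩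

theorem ncard_Arr_cons {m : ℕ} {M : Multiset ℕ} (hm : m ∉ M) {c : List ℕ → List ℕ → List ℕ}
    (hc : IsJoin m c) {P : List ℕ → Prop} {Q : List ℕ → Prop}
    (hP : ∀ u v, (∀ x ∈ u, x ∈ M) → (∀ x ∈ v, x ∈ M) → (P (c u v) ↔ Q v ∧ P u ∧ P v)) :
    (Arr P (m ::ₘ M) ι).ncard
      = Fintype.card ι * {t ∈ Arr P M (Option ι) | Q (t none)}.ncard := by
  rw [Arr_cons_eq_image hc hP, Set.InjOn.ncard_image, Set.ncard_prod, Set.ncard_univ,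
    Nat.card_eq_fintype_card]
  refine (joinAt_injOn hc).mono ?_
  rintro ⟨i, t⟩ ⟨-, ⟨ht, -⟩, -⟩ j hj
  exact hm (ht ▸ mem_sum_coe.2 ⟨j, hj⟩)

theorem ncard_Arr_none_eq_nil {κ : Type} [Fintype κ] {M : Multiset ℕ} {P : List ℕ → Prop} (h0 : P []) :
    {t ∈ Arr P M (Option κ) | t none = []}.ncard = (Arr P M κ).ncard := by
  have : {t ∈ Arr P M (Option κ) | t none = []}
      = (fun s (j : Option κ) => j.elim [] s) '' Arr P M κ := by
    ext t
    constructor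
    · rintro ⟨⟨h1, h2⟩, h3⟩
      refine ⟨fun j => t (some j), ⟨?_, fun j => h2 _⟩, ?_⟩
      · rw [Fintype.sum_option, h3] at h1
        simpa using h1
      · funext j
        rcases j with _ | j
        · exact h3.symm
        · rfl
    · rintro ⟨s, ⟨h1, h2⟩, rfl⟩
      refine ⟨⟨?_, ?_⟩, rfl⟩
      · rw [Fintype.sum_option]
        simpa using h1
      · rintro (_ | j)
        · exact h0
        · exact h2 j
  rw [this, Set.ncard_image_of_injective]
  intro s s' h
  funext j
  exact congrFun h (some j)

theorem finite_Arr {κ : Type} [Fintype κ] (P : List ℕ → Prop) (M : Multiset ℕ) :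
    (Arr P M κ).Finite := by
  have hfin : {l : List ℕ | (l : Multiset ℕ) ≤ M}.Finite := by
    refine (Multiset.finite_toSet (M.powerset.bind Multiset.lists)).subset fun l hl => ?_
    exact Multiset.mem_bind.2 ⟨l, Multiset.mem_powerset.2 hl, (Multiset.mem_lists_iff _ _).2 rfl⟩
  refine (Set.Finite.pi' fun _ : κ => hfin).subset fun s hs i => ?_
  rw [Set.mem_ofPred_eq, ← hs.1]
  exact Finset.single_le_sum (f := fun j => (s j : Multiset ℕ)) (fun j _ => Multiset.zero_le _)
    (Finset.mem_univ i)

end Arrangements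

end GenocchiCycles

namespace GenocchiCycles

/-! ### Removing the maximum, and the recursion for the counts -/

section Counting

/-- The predicate `P` admits `m` only at the end of a list when `m` is odd, and, when `m` is even,
only as a join by `c` whose second list is nonempty. -/
structure Splits (c : ℕ → List ℕ → List ℕ → List ℕ) (P : List ℕ → Prop) (N : ℕ) : Prop where
  join : ∀ m, IsJoin m (c m)
  nil : P []
  odd : ∀ m < N, Odd m → ∀ u v, (∀ x ∈ u, x < m) → (∀ x ∈ v, x < m) →
    (P (u ++ m :: v) ↔ v = [] ∧ P u)
  even : ∀ m < N, Even m → ∀ u v, (∀ x ∈ u, x < m) → (∀ x ∈ v, x < m) →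
    (P (c m u v) ↔ v ≠ [] ∧ P u ∧ P v)

theorem Icc_one_succ_val (m : ℕ) :
    (Finset.Icc 1 (m + 1)).val = (m + 1) ::ₘ (Finset.Icc 1 m).val := by
  rw [← Finset.insert_Icc_right_eq_Icc_add_one (by omega : 1 ≤ m + 1)]
  exact Finset.insert_val_of_notMem (by simp)

variable {c : ℕ → List ℕ → List ℕ → List ℕ} {P : List ℕ → Prop} {N : ℕ}

theorem Splits.ncard_Arr_odd (h : Splits c P N) {m : ℕ} (hm : m + 1 < N) (ho : Odd (m + 1))
    {ι : Type} [Fintype ι] :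
    (Arr P (Finset.Icc 1 (m + 1)).val ι).ncard
      = Fintype.card ι * (Arr P (Finset.Icc 1 m).val ι).ncard := by
  classical
  have hlt : ∀ x ∈ (Finset.Icc 1 m).val, x < m + 1 := fun x hx => by
    have := (Finset.mem_Icc (α := ℕ)).1 hx; omega
  rw [Icc_one_succ_val, ncard_Arr_cons (by simp) (isJoin_append (m + 1)) (Q := fun v => v = []),
    ncard_Arr_none_eq_nil h.nil]
  intro u v hu hv
  rw [h.odd _ hm ho u v (fun x hx => hlt x (hu x hx)) (fun x hx => hlt x (hv x hx))]
  constructor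
  · rintro ⟨rfl, h1⟩
    exact ⟨rfl, h1, h.nil⟩
  · exact fun h1 => ⟨h1.1, h1.2.1⟩

/-- The second piece becomes an extra member of the family, indexed by `none`; the subtracted term
counts families in which it is empty. -/
theorem Splits.ncard_Arr_even (h : Splits c P N) {m : ℕ} (hm : m + 1 < N) (he : Even (m + 1))
    {ι : Type} [Fintype ι] :
    ((Arr P (Finset.Icc 1 (m + 1)).val ι).ncard : ℚ)
      = Fintype.card ι * ((Arr P (Finset.Icc 1 m).val (Option ι)).ncard
        - (Arr P (Finset.Icc 1 m).val ι).ncard) := by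
  classical
  have hlt : ∀ x ∈ (Finset.Icc 1 m).val, x < m + 1 := fun x hx => by
    have := (Finset.mem_Icc (α := ℕ)).1 hx; omega
  have hcard := Set.ncard_inter_add_ncard_sdiff_eq_ncard (Arr P (Finset.Icc 1 m).val (Option ι))
    {t | t none = []} (finite_Arr _ _)
  have h1 : Arr P (Finset.Icc 1 m).val (Option ι) ∩ {t | t none = []}
    = {t ∈ Arr P (Finset.Icc 1 m).val (Option ι) | t none = []} := rfl
  have h2 : Arr P (Finset.Icc 1 m).val (Option ι) \ {t | t none = []}
    = {t ∈ Arr P (Finset.Icc 1 m).val (Option ι) | t none ≠ []} := rfl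
  rw [h1, h2, ncard_Arr_none_eq_nil h.nil] at hcard
  rw [Icc_one_succ_val, ncard_Arr_cons (by simp) (h.join (m + 1)) (Q := fun v => v ≠ []) fun u v
    hu hv => h.even _ hm he u v (fun x hx => hlt x (hu x hx)) (fun x hx => hlt x (hv x hx)),
    ← hcard]
  push_cast
  ring

theorem Splits.ncard_Arr (h : Splits c P N) (j : ℕ) (hj : 2 * j + 1 < N) {ι : Type} [Fintype ι] :
    ((Arr P (Finset.Icc 1 (2 * j + 1)).val ι).ncard : ℚ) = gandhi j (Fintype.card ι) := by
  induction j generalizing ι with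
  | zero =>
    have h0 : Arr P (Finset.Icc 1 0).val ι = {fun _ => []} := by
      ext s
      constructor
      · rintro ⟨h1, -⟩
        refine funext fun i => List.eq_nil_iff_forall_not_mem.2 fun x hx => ?_
        have := mem_sum_coe.2 ⟨i, hx⟩
        rw [h1] at this
        simp at this
      · rintro rfl
        exact ⟨by simp, fun _ => h.nil⟩
    rw [h.ncard_Arr_odd (m := 2 * 0) hj (by simp), h0]
    simp [gandhi]
  | succ j ih =>
    rw [h.ncard_Arr_odd (m := 2 * (j + 1)) hj ⟨j + 1, rfl⟩, Nat.cast_mul,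
      show 2 * (j + 1) = 2 * j + 1 + 1 by ring,
      h.ncard_Arr_even (by omega) ⟨j + 1, by ring⟩, ih (by omega), ih (by omega), gandhi,
      Fintype.card_option]
    ring

/-! ### Lists cut from cycles at the maximum -/

/-- The list `l` can occur in a chain of `R` between two elements equal to `N`. -/
def Frag (R : ℕ → ℕ → Prop) (N : ℕ) (l : List ℕ) : Prop := List.IsChain R (N :: (l ++ [N]))

variable {R : ℕ → ℕ → Prop}

theorem isChain_append_singleton_congr {l : List ℕ} {a b : ℕ} (hne : l ≠ [])
    (h : ∀ x ∈ l, R x a ↔ R x b) :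
    List.IsChain R (l ++ [a]) ↔ List.IsChain R (l ++ [b]) := by
  have h' := h _ (List.getLast_mem hne)
  simp only [List.isChain_append, List.getLast?_eq_getLast_of_ne_nil hne]
  simp [h']

theorem Frag_append_cons (R : ℕ → ℕ → Prop) (N m : ℕ) (u v : List ℕ) :
    Frag R N (u ++ m :: v)
      ↔ List.IsChain R ((N :: u) ++ [m]) ∧ List.IsChain R (m :: (v ++ [N])) := by
  simpa [Frag] using List.isChain_split (R := R) (c := m) (l₁ := N :: u) (l₂ := v ++ [N])

theorem isChain_cons_append_iff_Frag {m : ℕ} {v : List ℕ} (hR : ∀ x ∈ v, R m x ↔ R N x)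
    (hv : v ≠ []) : List.IsChain R (m :: (v ++ [N])) ↔ Frag R N v := by
  obtain ⟨x, v, rfl⟩ := List.exists_cons_of_ne_nil hv
  simp [Frag, List.isChain_cons_cons, hR x]

theorem Frag_nil (h : R N N) : Frag R N [] := by simpa [Frag] using h

theorem Frag_append_cons_of_odd {m : ℕ} {u v : List ℕ} (hpred : ∀ x, x = N ∨ x < m → (R x m ↔ R x N))
    (hsucc : ∀ y < m, ¬ R m y) (hN : R m N) (hu : ∀ x ∈ u, x < m) (hv : ∀ x ∈ v, x < m) :
    Frag R N (u ++ m :: v) ↔ v = [] ∧ Frag R N u := by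
  rw [Frag_append_cons, isChain_append_singleton_congr (b := N) (by simp) (by
    intro x hx
    rcases List.mem_cons.1 hx with hx | hx
    · exact hpred x (Or.inl hx)
    · exact hpred x (Or.inr (hu x hx)))]
  rcases v with _ | ⟨y, v⟩
  · simp [Frag, hN]
  · simp [List.isChain_cons_cons, hsucc y (hv y (by simp))]

theorem splits_DC {N : ℕ} (hN : Even N) :
    Splits (fun m u v => u ++ m :: v)
      (Frag (fun a b => (Odd a → a ≤ b) ∧ (Even a → b ≤ a)) N) N where
  join := isJoin_append
  nil := Frag_nil ⟨fun _ => le_rfl, fun _ => le_rfl⟩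
  odd m hm ho u v hu hv := by
    have ho' := Nat.not_even_iff_odd.2 ho
    refine Frag_append_cons_of_odd ?_ ?_ ?_ hu hv
    · rintro x (rfl | hx)
      · simp [hN, Nat.not_odd_iff_even.2 hN, hm.le]
      · rcases Nat.even_or_odd x with h | h
        · simp [h, Nat.not_odd_iff_even.2 h]; omega
        · simp [h, Nat.not_even_iff_odd.2 h]; omega
    · intro y hy h
      have := h.1 ho
      omega
    · exact ⟨fun _ => hm.le, fun h => absurd h ho'⟩
  even m hm he u v hu hv := by
    have he' := Nat.not_odd_iff_even.2 he
    have hN' := Nat.not_odd_iff_even.2 hN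
    rw [Frag_append_cons, isChain_append_singleton_congr (b := N) (by simp) (by
      intro x hx
      rcases List.mem_cons.1 hx with rfl | hx
      · simp [hN, hN', hm.le]
      · have := hu x hx
        rcases Nat.even_or_odd x with h | h
        · simp [h, Nat.not_odd_iff_even.2 h]; omega
        · simp [h, Nat.not_even_iff_odd.2 h]; omega)]
    by_cases hne : v = []
    · subst hne
      -- An even `m` may not be followed directly by the larger `N`.
      simp [he, hm]
    · rw [isChain_cons_append_iff_Frag _ hne]
      · simp [hne, Frag]
      · intro x hx
        have := hv x hx
        simp [he, he', hN, hN']; omega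

/-- Here the piece before `m` must be nonempty, since `N` followed by an even `m` is a forbidden
drop; hence the swapped join. -/
theorem splits_EC {N : ℕ} (hN : Even N) :
    Splits (fun m u v => v ++ m :: u) (Frag (fun a b => b < a → Even a ∧ Odd b) N) N where
  join := isJoin_append_swap
  nil := Frag_nil fun h => absurd h (lt_irrefl _)
  odd m hm ho u v hu hv := by
    refine Frag_append_cons_of_odd ?_ ?_ ?_ hu hv
    · rintro x (rfl | hx)
      · simp [hN, ho]
      · simp [hx.not_gt, (hx.trans hm).not_gt]
    · intro y hy h
      exact Nat.not_even_iff_odd.2 ho (h hy).1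
    · intro h
      omega
  even m hm he v u hv hu := by
    have he' := Nat.not_odd_iff_even.2 he
    have hright : List.IsChain (fun a b => b < a → Even a ∧ Odd b) (m :: (v ++ [N]))
        ↔ Frag (fun a b => b < a → Even a ∧ Odd b) N v := by
      by_cases hne : v = []
      · subst hne
        simp [Frag, hm.not_gt]
      · refine isChain_cons_append_iff_Frag (fun x hx => ?_) hne
        have := hv x hx
        simp [this, this.trans hm, he, hN]
    rw [Frag_append_cons, hright]
    rcases u with _ | ⟨y, u⟩
    · simp [hm, he']
    · have h : ∀ x ∈ y :: u, ((m < x → Even x ∧ Odd m) ↔ (N < x → Even x ∧ Odd N)) := by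
        intro x hx
        have := hu x hx
        simp [this.not_gt, (this.trans hm).not_gt]
      have h2 := isChain_append_singleton_congr
        (R := fun a b => b < a → Even a ∧ Odd b) (List.cons_ne_nil y u) h
      simp only [Frag, List.cons_append, List.isChain_cons_cons] at h2 ⊢
      rw [h2]
      simp only [ne_eq, reduceCtorEq, not_false_eq_true, true_and]
      tauto

/-- Since `m + 1` occurs once, each cycle has exactly one rotation that starts with it. -/
theorem ncard_cycles_eq_ncard_Arr (R : ℕ → ℕ → Prop) (m : ℕ) :
    {c : Cycle ℕ | c.toMultiset = (Finset.Icc 1 (m + 1)).val ∧ c.Chain R}.ncard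
      = (Arr (Frag R (m + 1)) (Finset.Icc 1 m).val Unit).ncard := by
  have himg : {c : Cycle ℕ | c.toMultiset = (Finset.Icc 1 (m + 1)).val ∧ c.Chain R}
      = (fun s : Unit → List ℕ => (((m + 1) :: s () : List ℕ) : Cycle ℕ)) ''
        Arr (Frag R (m + 1)) (Finset.Icc 1 m).val Unit := by
    ext c
    constructor
    · induction c using Quotient.inductionOn with
      | _ l =>
      rintro ⟨h1, h2⟩
      have h1' : (l : Multiset ℕ) = (Finset.Icc 1 (m + 1)).val := h1
      have hmem : m + 1 ∈ l := by
        rw [← Multiset.mem_coe, h1', Icc_one_succ_val]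
        exact Multiset.mem_cons_self _ _
      obtain ⟨u, v, rfl⟩ := List.append_of_mem hmem
      have hrot : ((u ++ (m + 1) :: v : List ℕ) : Cycle ℕ) = ((m + 1) :: (v ++ u) : List ℕ) := by
        rw [Cycle.coe_eq_coe]
        exact ⟨u.length, by simp [List.rotate_append_length_eq]⟩
      change Cycle.Chain R ((u ++ (m + 1) :: v : List ℕ) : Cycle ℕ) at h2
      rw [hrot, Cycle.chain_coe_cons] at h2
      refine ⟨fun _ => v ++ u, ⟨?_, fun _ => h2⟩, hrot.symm⟩
      rw [Icc_one_succ_val, (isJoin_append (m + 1)).coe, Multiset.cons_inj_right] at h1'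
      simpa [← h1'] using List.perm_append_comm
    · rintro ⟨s, ⟨h1, h2⟩, rfl⟩
      refine ⟨?_, (Cycle.chain_coe_cons _ _ _).2 (h2 ())⟩
      rw [Icc_one_succ_val, ← h1]
      simp
  rw [himg, Set.InjOn.ncard_image]
  rintro s ⟨h1, -⟩ s' ⟨h1', -⟩ h
  have h := Cycle.coe_eq_coe.1 h
  funext i
  have hnot : ∀ s : Unit → List ℕ, ∑ i, (s i : Multiset ℕ) = (Finset.Icc 1 m).val →
      m + 1 ∉ s () := fun s hs hmem => by
    have := hs ▸ mem_sum_coe.2 ⟨(), hmem⟩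
    simp at this
  obtain ⟨k, hk, hrot⟩ := List.isRotated_iff_mod.1 h
  rw [List.rotate_eq_drop_append_take hk] at hrot
  rcases k with _ | k
  · simpa using hrot
  -- A nontrivial rotation brings `m + 1` back to the front only if nothing precedes it, so the
  -- rotation has gone full circle.
  · rw [List.drop_succ_cons, List.take_succ_cons] at hrot
    have := (List.append_cons_inj_of_notMem (x₁ := List.drop k (s ())) (x₂ := [])
      (fun hx => hnot s h1 (List.mem_of_mem_drop hx))
      (fun hx => hnot s h1 (List.mem_of_mem_take hx))).1 hrot
    obtain ⟨h3, -, h4⟩ := this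
    rw [← h4, List.take_of_length_le (List.drop_eq_nil_iff.1 h3)]

end Counting

theorem ncard_DC (j : ℕ) : ((DC (2 * (j + 1))).ncard : ℚ) = genocchi (j + 1) := by
  rw [← gandhi_one, ← Fintype.card_unit,
    ← (splits_DC (N := 2 * j + 1 + 1) ⟨j + 1, by ring⟩).ncard_Arr j (by omega),
    ← ncard_cycles_eq_ncard_Arr]
  rfl

theorem ncard_EC (j : ℕ) : ((EC (2 * (j + 1))).ncard : ℚ) = genocchi (j + 1) := by
  rw [← gandhi_one, ← Fintype.card_unit,
    ← (splits_EC (N := 2 * j + 1 + 1) ⟨j + 1, by ring⟩).ncard_Arr j (by omega),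
    ← ncard_cycles_eq_ncard_Arr]
  rfl

end GenocchiCycles

theorem mainTheorem3 (n : ℕ) (hn : 1 ≤ n) :
    (GenocchiCycles.EC (2 * n)).ncard = (GenocchiCycles.DC (2 * n)).ncard ∧
      ((GenocchiCycles.DC (2 * n)).ncard : ℚ) = GenocchiCycles.genocchi n := by
  obtain ⟨j, rfl⟩ : ∃ j, n = j + 1 := ⟨n - 1, by omega⟩
  refine ⟨?_, GenocchiCycles.ncard_DC j⟩
  have := (GenocchiCycles.ncard_EC j).trans (GenocchiCycles.ncard_DC j).symm
  exact_mod_cast this
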